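/- Call a real matrix totally positive (TP) if all its minors are nonnegative. Call a sequence $(a_n)_{n\ge 0}$ of polynomials in $\mathbb{R}[q]$ $q$-Stieltjes moment ($q$-SM) if every minor of its infinite Hankel matrix $[a_{i+j}]_{i,j\ge 0}$ is a polynomial in $q$ with nonnegative coefficients. With $\mathcal{L}[a_i]=a_{i-1}a_{i+1}-a_i^2$, call it $3$-$q$-log-convex if, for each $m\le 3$, all terms of $\mathcal{L}^m[a_i]$ $(i\ge m)$ have nonnegative coefficients. The same terms are used for sequences $(a_n)_{n\ge1}$ after re-indexing. A real sequence $(a_n)_{n\ge 0}$ is a Stieltjes moment (SM) sequence if there is a nonnegative measure $\mu$ on $[0,\infty)$ such that $a_n=\int_0^\infty x^n\,d\mu(x)$ (with all these integrals finite) for all $n\ge 0$. A convolution $(x,y)\mapsto z$ preserves the SM property if $z$ is SM whenever $x=(x_n)_{n\ge0}$ and $y=(y_n)_{n\ge0}$ both are. The convention $0^0=1$ is used, and entries of the triangles below with $k>n$ are $0$. **Proposition.** (i) The matrices $\left[\binom{n}{k}k^{n-k}\right]_{n,k\ge 0}$ and $\left[\binom{n-1}{k-1}n^{n-k}\right]_{n,k\ge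 1}$ are TP. (ii) The matrices $\left[\binom{n}{k}k^{n-k}\,k!\right]_{n,k\ge 0}$ and $\left[\binom{n-1}{k-1}n^{n-k}\,k!\right]_{n,k\ge 1}$ are TP. (iii) Let $\mathcal{I}_0(q)=1$ and $\mathcal{I}_n(q)=\sum_{k=1}^n\binom{n-1}{k-1}n^{n-k}q^k$ for $n\ge 1$. The sequence $(\mathcal{I}_n(q))_{n\ge 0}$ is $q$-SM and $3$-$q$-log-convex. (iv) The sequence $\left((1+qn)^{n-1}\right)_{n\ge 1}$ is $q$-SM and $3$-$q$-log-convex. (v) The sequence $(n^{n-1})_{n\ge 1}$ is SM. (vi) The convolution given by $z_0=x_0y_0$ and $z_n=\sum_{k=1}^n\binom{n-1}{k-1}n^{n-k}x_ky_{n-k}$ for $n\ge 1$, and the convolution $z_n=\sum_{k=0}^n\binom{n}{k}(n+1)^{n-k}x_ky_{n-k}$ for $n\ge 0$, both preserve the SM property. -/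

import Mathlib

open Polynomial

/-- A (possibly infinite) real matrix is totally positive if all its minors, taken along
increasing rows and increasing columns, are nonnegative. -/
def IsTotallyPositive {m n : Type*} [Preorder m] [Preorder n] (M : Matrix m n ℝ) : Prop :=
  ∀ (r : ℕ) (rows : Fin r → m) (cols : Fin r → n), StrictMono rows → StrictMono cols →
    0 ≤ (M.submatrix rows cols).det

/-- A real polynomial in `q` all of whose coefficients are nonnegative. -/
def HasNonnegCoeffs (p : ℝ[X]) : Prop := ∀ i : ℕ, 0 ≤ p.coeff i

/-- `q`-total positivity: every minor is a polynomial in `q` with nonnegative coefficients. -/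
def IsQTotallyPositive {m n : Type*} [Preorder m] [Preorder n] (M : Matrix m n ℝ[X]) : Prop :=
  ∀ (r : ℕ) (rows : Fin r → m) (cols : Fin r → n), StrictMono rows → StrictMono cols →
    HasNonnegCoeffs (M.submatrix rows cols).det

/-- The infinite Hankel matrix `[a_{i+j}]_{i,j ≥ 0}`. -/
def hankelMatrix {R : Type*} (a : ℕ → R) : Matrix ℕ ℕ R := Matrix.of fun i j => a (i + j)

/-- A `q`-Stieltjes moment sequence of polynomials: its Hankel matrix is `q`-totally positive. -/
def IsQStieltjesMoment (a : ℕ → ℝ[X]) : Prop := IsQTotallyPositive (hankelMatrix a)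

/-- The operator `𝓛[a_i] = a_{i-1} a_{i+1} - a_i ^ 2`, for `i ≥ 1`, re-indexed to start at `0`. -/
noncomputable def logConvexOp (a : ℕ → ℝ[X]) : ℕ → ℝ[X] :=
  fun i => a i * a (i + 2) - a (i + 1) ^ 2

/-- `k`-`q`-log-convexity: for every `m ≤ k`, all terms of `𝓛^m[a]` have nonnegative
coefficients. -/
def IsKQLogConvex (k : ℕ) (a : ℕ → ℝ[X]) : Prop :=
  ∀ m ≤ k, ∀ i : ℕ, HasNonnegCoeffs (logConvexOp^[m] a i)

/-- A Stieltjes moment sequence: `a_k = ∫_0^∞ x^k dμ(x)` for a nonnegative measure `μ`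
all of whose moments are finite. -/
def IsStieltjesMoment (a : ℕ → ℝ) : Prop :=
  ∃ μ : MeasureTheory.Measure ℝ, ∀ k : ℕ,
    MeasureTheory.IntegrableOn (fun x : ℝ => x ^ k) (Set.Ici 0) μ ∧
      a k = ∫ x in Set.Ici (0 : ℝ), x ^ k ∂μ

/-- The convolution `z_n = ∑_{k=0}^n A_{n,k} x_k y_{n-k}` given by a triangle `A`. -/
noncomputable def triangleConvolution (A : ℕ → ℕ → ℝ) (x y : ℕ → ℝ) : ℕ → ℝ :=
  fun n => ∑ k ∈ Finset.range (n + 1), A n k * x k * y (n - k)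

/-- The `A`-convolution maps each pair of Stieltjes moment sequences to such a sequence. -/
def ConvolutionPreservesSM (A : ℕ → ℕ → ℝ) : Prop :=
  ∀ x y : ℕ → ℝ, IsStieltjesMoment x → IsStieltjesMoment y →
    IsStieltjesMoment (triangleConvolution A x y)

/-- The numbers `binom(n-1, k-1) n^(n-k)` for `n, k ≥ 1`, extended to `n, k ≥ 0` by
`1` at `(0, 0)` and `0` elsewhere on the border: the coefficient of `q^k t^n / n!` in
`exp (q T(t))`, where `T(t) = ∑_{n ≥ 1} n^(n-1) t^n / n!`. -/
noncomputable def inverseIdempotent (n k : ℕ) : ℝ :=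
  if n = 0 ∧ k = 0 then 1
  else if n = 0 ∨ k = 0 then 0
  else ((n - 1).choose (k - 1) : ℝ) * (n : ℝ) ^ (n - k)

/-- The row polynomials: `1` for `n = 0`, and `∑_{k=1}^n binom(n-1, k-1) n^(n-k) q^k` for
`n ≥ 1`. -/
noncomputable def inverseIdempotentPoly (n : ℕ) : ℝ[X] :=
  if n = 0 then 1
  else ∑ k ∈ Finset.Icc 1 n, C (((n - 1).choose (k - 1) : ℝ) * (n : ℝ) ^ (n - k)) * X ^ k

/-!
A row-finite matrix acts on `R[X]` as the operator sending `X ^ n` to its `n`-th row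
polynomial, so that products of infinite matrices need no truncation. The operator
`(1 - y D)⁻¹ exp (y D) (X + x)`, with `D` the derivative, maps each tree polynomial
`(X + x + (n + 1) y) ^ n` to the next one, and its factors, written in another order, do the same
for the Abel polynomials `(X + x) (X + x + n y) ^ (n - 1)`. Every factor is totally positive, and
by Cauchy–Binet so are the triangles of coefficients. If `Θ` is such an operator, then the Hankel
matrix of the constant terms of `Θ ^ n 1` pairs the polynomials `Θ ^ i 1` with the functionals
`p ↦ (Θ ^ j p)(0)`, hence factors into totally positive matrices as well.

For log-convexity, the iterates of `𝓛` are expressed by Hankel determinants of order at most four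
through the Desnanot–Jacobi identity. For Stieltjes moments, a totally positive Hankel matrix makes
the functional `X ^ n ↦ a n` nonnegative on the squares `q ^ 2` and on `X q ^ 2`, hence on every
polynomial nonnegative on the half-line, and Riesz extension followed by
the Riesz–Markov–Kakutani theorem represents it by a measure. By bilinearity a convolution only has
to be tested on point masses, where the binomial theorem turns it into the tree and Abel sequences.
-/

section CauchyBinet

open Matrix

variable {R n : Type*} [CommRing R] [Fintype n] {r : ℕ}

theorem det_mul_eq_sum_prod_mul_det (A : Matrix (Fin r) n R) (B : Matrix n (Fin r) R) :
    (A * B).det = ∑ p : Fin r → n, (∏ i, A i (p i)) * (B.submatrix p id).det := by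
  classical
  have rows_eq : A * B = fun i => ∑ j, A i j • B j := by
    ext i k
    simp only [Matrix.mul_apply, Finset.sum_apply, Pi.smul_apply, smul_eq_mul]
  rw [rows_eq]
  exact (MultilinearMap.map_sum detRowAlternating.toMultilinearMap fun i j => A i j • B j).trans
    (Finset.sum_congr rfl fun p _ => MultilinearMap.map_smul_univ _ _ _)

theorem sum_eq_sum_orderEmb_sum_perm [LinearOrder n] {M : Type*} [AddCommMonoid M]
    (F : (Fin r → n) → M) (hF : ∀ p, ¬ Function.Injective p → F p = 0) :
    ∑ p, F p = ∑ f : Fin r ↪o n, ∑ σ : Equiv.Perm (Fin r), F (f ∘ σ) := by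
  rw [← Finset.sum_product', Finset.univ_product_univ]
  symm
  refine Finset.sum_of_injOn (fun fσ : (Fin r ↪o n) × Equiv.Perm (Fin r) => fσ.1 ∘ fσ.2)
    ?_ (by simp) (fun p _ hp => hF p fun hinj => hp ?_) (fun _ _ => rfl)
  · rintro ⟨f, σ⟩ - ⟨g, τ⟩ - (h : f ∘ σ = g ∘ τ)
    have range_eq : Set.range f = Set.range g := by
      rw [← σ.surjective.range_comp, h, τ.surjective.range_comp]
    obtain rfl : f = g :=
      DFunLike.coe_injective ((f.strictMono.range_inj g.strictMono).1 range_eq)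
    exact Prod.ext rfl (Equiv.ext fun i => f.injective (congrFun h i))
  · have sorted : StrictMono (p ∘ Tuple.sort p) :=
      (Tuple.monotone_sort p).strictMono_of_injective (hinj.comp (Tuple.sort p).injective)
    refine ⟨(OrderEmbedding.ofStrictMono _ sorted, (Tuple.sort p)⁻¹), by simp, ?_⟩
    ext i
    simp

theorem det_mul_eq_sum_orderEmb [LinearOrder n] (A : Matrix (Fin r) n R)
    (B : Matrix n (Fin r) R) :
    (A * B).det = ∑ f : Fin r ↪o n, (A.submatrix id f).det * (B.submatrix f id).det := by
  rw [det_mul_eq_sum_prod_mul_det, sum_eq_sum_orderEmb_sum_perm]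
  · refine Finset.sum_congr rfl fun f _ => ?_
    rw [← det_transpose (A.submatrix id f), det_apply', Finset.sum_mul]
    refine Finset.sum_congr rfl fun σ _ => ?_
    rw [show B.submatrix (f ∘ σ) id = (B.submatrix f id).submatrix σ id from rfl, det_permute]
    simp only [transpose_apply, submatrix_apply, id, Function.comp_apply]
    ring
  · intro p hp
    obtain ⟨i, j, hij, hne⟩ := Function.not_injective_iff.1 hp
    rw [det_zero_of_row_eq hne (by ext k; simp only [submatrix_apply, hij]), mul_zero]

end CauchyBinet

section Minors

open Matrix

variable {R : Type*} [CommRing R]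

theorem det_eq_mul_det_succ_of_row {r : ℕ} (M : Matrix (Fin (r + 1)) (Fin (r + 1)) R)
    (h : ∀ j : Fin r, M 0 j.succ = 0) :
    M.det = M 0 0 * (M.submatrix Fin.succ Fin.succ).det := by
  rw [det_succ_row_zero, Fin.sum_univ_succ]
  simp [h]

theorem det_eq_mul_det_succ_of_col {r : ℕ} (M : Matrix (Fin (r + 1)) (Fin (r + 1)) R)
    (h : ∀ i : Fin r, M i.succ 0 = 0) :
    M.det = M 0 0 * (M.submatrix Fin.succ Fin.succ).det := by
  rw [← det_transpose, det_eq_mul_det_succ_of_row Mᵀ h, ← det_transpose (M.submatrix _ _)]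
  rfl

theorem det_eq_zero_of_col_eq_mul {n : Type*} [Fintype n] [DecidableEq n] {M : Matrix n n R}
    {j k : n} (hjk : j ≠ k) {a : R} (h : ∀ i, M i j = M i k * a) : M.det = 0 := by
  have hM : M = M.updateCol j (a • fun i => M i k) := by
    ext i l
    rw [updateCol_apply]
    split_ifs with hl
    · rw [hl, h, Pi.smul_apply, smul_eq_mul, mul_comm]
    · rfl
  rw [hM, det_updateCol_smul, det_updateCol_eq_zero hjk.symm, mul_zero]

/-- Total positivity relative to a subsemiring `S`, whose elements count as nonnegative: all
minors along increasing rows and columns lie in `S`. With `S` the nonnegative reals this is total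
positivity, and with `S` the polynomials with nonnegative coefficients it is `q`-total
positivity. -/
def MinorsMem {m n : Type*} [Preorder m] [Preorder n] (S : Subsemiring R)
    (M : Matrix m n R) : Prop :=
  ∀ (r : ℕ) (rows : Fin r → m) (cols : Fin r → n), StrictMono rows → StrictMono cols →
    (M.submatrix rows cols).det ∈ S

variable {S : Subsemiring R} {m n : Type*} [Preorder m] [Preorder n]

namespace MinorsMem

theorem transpose {M : Matrix m n R} (h : MinorsMem S M) : MinorsMem S Mᵀ := by
  intro r rows cols hrows hcols
  rw [← det_transpose]
  exact h r cols rows hcols hrows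

theorem submatrix {m' n' : Type*} [Preorder m'] [Preorder n'] {M : Matrix m n R}
    (h : MinorsMem S M) {f : m' → m} {g : n' → n} (hf : StrictMono f) (hg : StrictMono g) :
    MinorsMem S (M.submatrix f g) :=
  fun r _ _ hrows hcols => h r _ _ (hf.comp hrows) (hg.comp hcols)

theorem mul_col {M : Matrix m n R} (h : MinorsMem S M) {c : n → R} (hc : ∀ j, c j ∈ S) :
    MinorsMem S (Matrix.of fun i j => M i j * c j) := by
  intro r rows cols hrows hcols
  have det_eq : ((Matrix.of fun i j => M i j * c j).submatrix rows cols).det =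
      (∏ j, c (cols j)) * (M.submatrix rows cols).det := by
    rw [← det_mul_row]
    congr 1
    ext i j
    exact mul_comm _ _
  exact det_eq ▸ mul_mem (prod_mem fun j _ => hc _) (h r rows cols hrows hcols)

theorem of_forall_fin_rows {A : Matrix ℕ n R}
    (h : ∀ M, MinorsMem S (A.submatrix (Fin.val : Fin M → ℕ) id)) : MinorsMem S A := by
  intro r rows cols hrows hcols
  have rows_lt : ∀ i, rows i < Finset.univ.sup rows + 1 := fun i =>
    Nat.lt_succ_of_le (Finset.le_sup (Finset.mem_univ i))
  exact h _ r (fun i => ⟨rows i, rows_lt i⟩) cols (fun _ _ hij => hrows hij) hcols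

theorem of_zero_row_eq_single {M : ℕ} {A : Matrix (Fin (M + 1)) ℕ R}
    (hzero : A 0 = Pi.single 0 1) (hsucc : MinorsMem S (A.submatrix Fin.succ id)) :
    MinorsMem S A := by
  have rows_ne_zero : ∀ (r : ℕ) (rows : Fin r → Fin (M + 1)) (cols : Fin r → ℕ),
      StrictMono rows → StrictMono cols → (∀ i, rows i ≠ 0) →
      (A.submatrix rows cols).det ∈ S := by
    intro r rows cols hrows hcols hne
    simpa [Matrix.submatrix, Function.comp_def] using
      hsucc r (fun i => (rows i).pred (hne i)) cols (fun _ _ hij => by simpa using hrows hij) hcols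
  rintro (_ | r) rows cols hrows hcols
  · simp
  have row_succ_ne (i : Fin r) : rows i.succ ≠ 0 := (hrows i.succ_pos).ne_bot
  by_cases h : rows 0 = 0
  · rw [det_eq_mul_det_succ_of_row]
    · refine mul_mem ?_ (rows_ne_zero r _ _ (hrows.comp Fin.strictMono_succ)
        (hcols.comp Fin.strictMono_succ) row_succ_ne)
      rw [submatrix_apply, h, hzero, Pi.single_apply]
      split_ifs
      exacts [one_mem S, zero_mem S]
    · intro j
      have col_ne : cols j.succ ≠ 0 := ((Nat.zero_le _).trans_lt (hcols j.succ_pos)).ne'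
      rw [submatrix_apply, h, hzero, Pi.single_eq_of_ne col_ne]
  · exact rows_ne_zero _ rows cols hrows hcols (Fin.cases h row_succ_ne)

theorem of_forall_fin_rows_succ {A : Matrix ℕ ℕ R} (hzero : A 0 = Pi.single 0 1)
    (hsucc : ∀ M, MinorsMem S (A.submatrix (Fin.val : Fin M → ℕ) id) →
      MinorsMem S (A.submatrix (fun i : Fin M => (i : ℕ) + 1) id)) : MinorsMem S A := by
  refine of_forall_fin_rows fun M => ?_
  induction M with
  | zero =>
    rintro (_ | r) rows cols - -
    · simp
    · exact (rows 0).elim0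
  | succ M ih => exact of_zero_row_eq_single hzero (hsucc M ih)

theorem of_upper_bidiagonal {M : Matrix ℕ ℕ R} (hmem : ∀ i j, M i j ∈ S)
    (hzero : ∀ i j, j < i ∨ i + 1 < j → M i j = 0) : MinorsMem S M := by
  intro r
  induction r with
  | zero => simp
  | succ r ih =>
    intro rows cols hrows hcols
    have corner_mul_mem : M.submatrix rows cols 0 0 *
        ((M.submatrix rows cols).submatrix Fin.succ Fin.succ).det ∈ S :=
      mul_mem (hmem _ _) (ih _ _ (hrows.comp Fin.strictMono_succ) (hcols.comp Fin.strictMono_succ))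
    rcases lt_or_ge (rows 0) (cols 0) with h | h
    · rw [det_eq_mul_det_succ_of_row]
      · exact corner_mul_mem
      · intro j
        have := hcols j.succ_pos
        exact hzero _ _ (by lia)
    · rw [det_eq_mul_det_succ_of_col]
      · exact corner_mul_mem
      · intro i
        exact hzero _ _ (Or.inl (h.trans_lt (hrows i.succ_pos)))

/-- The inverses of bidiagonal matrices have this form. -/
theorem of_lower_triangular_of_mul {ι : Type*} [LinearOrder ι] {M : Matrix ι ι R}
    (hmem : ∀ i j, M i j ∈ S) (hzero : ∀ i j, i < j → M i j = 0)
    (hmul : ∀ i j k, k ≤ j → j ≤ i → M i k = M i j * M j k) : MinorsMem S M := by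
  intro r
  induction r with
  | zero => simp
  | succ r ih =>
    intro rows cols hrows hcols
    by_cases h : ∀ j : Fin r, rows 0 < cols j.succ
    · rw [det_eq_mul_det_succ_of_row _ fun j => hzero _ _ (h j)]
      exact mul_mem (hmem _ _)
        (ih _ _ (hrows.comp Fin.strictMono_succ) (hcols.comp Fin.strictMono_succ))
    · push Not at h
      obtain ⟨j, hj⟩ := h
      rw [det_eq_zero_of_col_eq_mul (j.succ_ne_zero).symm fun i =>
        hmul _ _ _ (hcols j.succ_pos).le (hj.trans (hrows.monotone i.zero_le))]
      exact zero_mem S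

end MinorsMem

end Minors

section TotallyPositiveOperators

open Matrix

variable {R m n : Type*} [CommRing R] [Preorder m] [Preorder n] {S : Subsemiring R}

/-- The matrix whose `i`-th row is the coefficient sequence of `p i`. -/
def coeffMatrix (p : m → R[X]) : Matrix m ℕ R := Matrix.of fun i k => (p i).coeff k

/-- A linear operator on `R[X]` is totally positive relative to `S` if its matrix in the monomial
basis is. The `n`-th row of that matrix is the image of `X ^ n`, so that every row is finite and
matrix products make sense without truncation. -/
def IsTotallyPositiveOperator (S : Subsemiring R) (f : Module.End R R[X]) : Prop :=
  MinorsMem S (coeffMatrix fun n : ℕ => f (X ^ n))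

theorem linearMap_apply_eq_sum_coeff_mul (ℓ : R[X] →ₗ[R] R) {p : R[X]} {N : ℕ}
    (hp : p.natDegree < N) : ℓ p = ∑ k : Fin N, p.coeff k * ℓ (X ^ (k : ℕ)) := by
  conv_lhs => rw [p.as_sum_range' N hp]
  rw [map_sum, ← Fin.sum_univ_eq_sum_range fun k => ℓ (monomial k (p.coeff k))]
  refine Finset.sum_congr rfl fun k _ => ?_
  rw [← C_mul_X_pow_eq_monomial, ← smul_eq_C_mul, map_smul, smul_eq_mul]

theorem minorsMem_pairing {p : m → R[X]} {ℓ : n → R[X] →ₗ[R] R} (hp : MinorsMem S (coeffMatrix p))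
    (hℓ : MinorsMem S (Matrix.of fun (k : ℕ) j => ℓ j (X ^ k))) :
    MinorsMem S (Matrix.of fun i j => ℓ j (p i)) := by
  intro r rows cols hrows hcols
  obtain ⟨N, hN⟩ : ∃ N, ∀ i, (p (rows i)).natDegree < N :=
    ⟨Finset.univ.sup (fun i => (p (rows i)).natDegree) + 1, fun i =>
      Nat.lt_succ_of_le (Finset.le_sup (f := fun i => (p (rows i)).natDegree) (Finset.mem_univ i))⟩
  have factorization : (Matrix.of fun i j => ℓ j (p i)).submatrix rows cols =
      ((coeffMatrix p).submatrix rows (Fin.val : Fin N → ℕ)) *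
        (Matrix.of fun (k : ℕ) j => ℓ j (X ^ k)).submatrix (Fin.val : Fin N → ℕ) cols := by
    ext i j
    exact linearMap_apply_eq_sum_coeff_mul (ℓ (cols j)) (hN i)
  rw [factorization, det_mul_eq_sum_orderEmb]
  exact sum_mem fun f _ => mul_mem
    (hp r _ _ hrows (Fin.val_strictMono.comp f.strictMono))
    (hℓ r _ _ (Fin.val_strictMono.comp f.strictMono) hcols)

namespace IsTotallyPositiveOperator

variable {f g : Module.End R R[X]}

theorem coeffMatrix_apply (hf : IsTotallyPositiveOperator S f) {p : m → R[X]}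
    (hp : MinorsMem S (coeffMatrix p)) : MinorsMem S (coeffMatrix fun i => f (p i)) :=
  minorsMem_pairing (ℓ := fun k => lcoeff R k ∘ₗ f) hp hf

theorem mul (hf : IsTotallyPositiveOperator S f) (hg : IsTotallyPositiveOperator S g) :
    IsTotallyPositiveOperator S (f * g) :=
  hf.coeffMatrix_apply hg

theorem coeffMatrix_of_iterate (hf : IsTotallyPositiveOperator S f) {p : ℕ → R[X]}
    (hzero : p 0 = 1) (hsucc : ∀ n, p (n + 1) = f (p n)) : MinorsMem S (coeffMatrix p) := by
  refine MinorsMem.of_forall_fin_rows_succ ?_ fun M hM => ?_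
  · ext k
    rw [coeffMatrix, Matrix.of_apply, hzero, coeff_one, Pi.single_apply]
  · have rows_succ : (coeffMatrix p).submatrix (fun i : Fin M => (i : ℕ) + 1) id =
        coeffMatrix fun i : Fin M => f (p i) := by
      ext i k
      exact congrArg (coeff · k) (hsucc i)
    exact rows_succ ▸ hf.coeffMatrix_apply hM

theorem minorsMem_coeff_zero_pow (hf : IsTotallyPositiveOperator S f) :
    MinorsMem S (Matrix.of fun n k : ℕ => ((f ^ k) (X ^ n)).coeff 0) := by
  refine (MinorsMem.of_forall_fin_rows_succ ?_ fun M hM => ?_).transpose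
    (M := Matrix.of fun k n : ℕ => ((f ^ k) (X ^ n)).coeff 0)
  · ext n
    simp [coeff_X_pow, Pi.single_apply, eq_comm]
  · have cols_succ : MinorsMem S
        (Matrix.of fun (n : ℕ) (k : Fin M) => ((f ^ (k : ℕ)) (f (X ^ n))).coeff 0) :=
      minorsMem_pairing (ℓ := fun k : Fin M => lcoeff R 0 ∘ₗ f ^ (k : ℕ)) hf hM.transpose
    exact cols_succ.transpose

theorem minorsMem_hankelMatrix (hf : IsTotallyPositiveOperator S f) {p : ℕ → R[X]}
    (hzero : p 0 = 1) (hsucc : ∀ n, p (n + 1) = f (p n)) :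
    MinorsMem S (hankelMatrix fun n => (p n).coeff 0) := by
  have hankel_eq : hankelMatrix (fun n => (p n).coeff 0) =
      Matrix.of fun i j => ((f ^ j) (p i)).coeff 0 := by
    have shift (i j : ℕ) : p (i + j) = (f ^ j) (p i) := by
      induction j with
      | zero => rfl
      | succ j ih => rw [← add_assoc, hsucc, ih, pow_succ', Module.End.mul_apply]
    ext i j
    exact congrArg (coeff · 0) (shift i j)
  rw [hankel_eq]
  exact minorsMem_pairing (ℓ := fun j => lcoeff R 0 ∘ₗ f ^ j)
    (hf.coeffMatrix_of_iterate hzero hsucc) hf.minorsMem_coeff_zero_pow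

theorem mulLeft_X_add_C {x : R} (hx : x ∈ S) :
    IsTotallyPositiveOperator S (LinearMap.mulLeft R (X + C x)) := by
  have entry (n k : ℕ) : coeffMatrix (fun n : ℕ => LinearMap.mulLeft R (X + C x) (X ^ n)) n k =
      (if k = n + 1 then 1 else 0) + if k = n then x else 0 := by
    simp only [coeffMatrix, of_apply, LinearMap.mulLeft_apply, add_mul, ← pow_succ', coeff_add,
      coeff_C_mul, coeff_X_pow, mul_ite, mul_one, mul_zero]
  refine MinorsMem.of_upper_bidiagonal (fun n k => ?_) fun n k h => ?_
  · rw [entry]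
    refine add_mem ?_ ?_ <;> split_ifs <;> simp [hx]
  · rw [entry, if_neg (by lia), if_neg (by lia), add_zero]

theorem taylor {y : R} (hy : y ∈ S) : IsTotallyPositiveOperator S (taylor y) :=
  (mulLeft_X_add_C hy).coeffMatrix_of_iterate (by simp) fun n => by
    simp [pow_succ']

theorem derivative : IsTotallyPositiveOperator S (R := R) Polynomial.derivative := by
  have entry (n k : ℕ) : coeffMatrix (fun n : ℕ => Polynomial.derivative (X ^ n : R[X])) n k =
      if n = k + 1 then (k + 1 : R) else 0 := by
    simp [coeffMatrix, coeff_derivative, coeff_X_pow, eq_comm]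
  refine (MinorsMem.of_upper_bidiagonal (fun k n => ?_) fun k n h => ?_).transpose
    (M := (coeffMatrix fun n : ℕ => Polynomial.derivative (X ^ n : R[X]))ᵀ)
  · rw [transpose_apply, entry]
    split_ifs
    exacts [add_mem (natCast_mem S k) (one_mem S), zero_mem S]
  · rw [transpose_apply, entry, if_neg (by lia)]

end IsTotallyPositiveOperator

/-- The image of `X ^ n` under `derivativeResolvent y`. -/
noncomputable def derivativeResolventXPow (y : R) : ℕ → R[X]
  | 0 => 1
  | n + 1 => X ^ (n + 1) + C ((n + 1) * y) * derivativeResolventXPow y n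

/-- The operator `(1 - y D)⁻¹ = ∑ i, y ^ i D ^ i`, where `D` is the derivative. -/
noncomputable def derivativeResolvent (y : R) : Module.End R R[X] :=
  (basisMonomials R).constr R (derivativeResolventXPow y)

theorem derivativeResolvent_X_pow (y : R) (n : ℕ) :
    derivativeResolvent y (X ^ n) = derivativeResolventXPow y n := by
  rw [← monomial_one_right_eq_X_pow]
  exact (basisMonomials R).constr_basis R (derivativeResolventXPow y) n

theorem derivativeResolvent_sub_C_mul_derivative (y : R) (p : R[X]) :
    derivativeResolvent y (p - C y * derivative p) = p := by
  suffices h : derivativeResolvent y ∘ₗ (LinearMap.id - y • derivative) = LinearMap.id by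
    simpa [smul_eq_C_mul] using LinearMap.congr_fun h p
  refine (basisMonomials R).ext fun n => ?_
  simp only [coe_basisMonomials, monomial_one_right_eq_X_pow]
  rcases n with _ | n
  · simpa [derivativeResolventXPow] using derivativeResolvent_X_pow y 0
  · have derivative_eq : y • derivative (X ^ (n + 1) : R[X]) = ((n + 1) * y) • X ^ n := by
      simp [smul_eq_C_mul]
      ring
    rw [LinearMap.comp_apply, LinearMap.sub_apply, LinearMap.smul_apply, derivative_eq, map_sub,
      map_smul, LinearMap.id_apply, derivativeResolvent_X_pow, derivativeResolvent_X_pow,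
      derivativeResolventXPow, smul_eq_C_mul, add_sub_cancel_right]

theorem coeff_derivativeResolventXPow_succ (y : R) (n k : ℕ) :
    (derivativeResolventXPow y (n + 1)).coeff k =
      (if k = n + 1 then 1 else 0) + (n + 1) * y * (derivativeResolventXPow y n).coeff k := by
  rw [derivativeResolventXPow, coeff_add, coeff_C_mul, coeff_X_pow]

theorem coeff_derivativeResolventXPow_of_lt (y : R) {n k : ℕ} (h : n < k) :
    (derivativeResolventXPow y n).coeff k = 0 := by
  induction n with
  | zero => rw [derivativeResolventXPow, coeff_one, if_neg h.ne']
  | succ n ih =>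
    rw [coeff_derivativeResolventXPow_succ, if_neg h.ne', ih (by lia), mul_zero, add_zero]

theorem coeff_derivativeResolventXPow_self (y : R) (n : ℕ) :
    (derivativeResolventXPow y n).coeff n = 1 := by
  cases n with
  | zero => exact coeff_one_zero
  | succ n =>
    rw [coeff_derivativeResolventXPow_succ, if_pos rfl,
      coeff_derivativeResolventXPow_of_lt y n.lt_succ_self, mul_zero, add_zero]

theorem coeff_derivativeResolventXPow_mem {y : R} (hy : y ∈ S) (n k : ℕ) :
    (derivativeResolventXPow y n).coeff k ∈ S := by
  induction n with
  | zero =>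
    rw [derivativeResolventXPow, coeff_one]
    split_ifs <;> simp
  | succ n ih =>
    rw [coeff_derivativeResolventXPow_succ]
    refine add_mem ?_ (mul_mem (mul_mem (add_mem (natCast_mem S n) (one_mem S)) hy) ih)
    split_ifs <;> simp

theorem coeff_derivativeResolventXPow_mul (y : R) {i j k : ℕ} (hkj : k ≤ j) (hji : j ≤ i) :
    (derivativeResolventXPow y i).coeff k =
      (derivativeResolventXPow y i).coeff j * (derivativeResolventXPow y j).coeff k := by
  induction i, hji using Nat.le_induction with
  | base => rw [coeff_derivativeResolventXPow_self, one_mul]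
  | succ i hji ih =>
    rw [coeff_derivativeResolventXPow_succ, coeff_derivativeResolventXPow_succ,
      if_neg (by lia), if_neg (by lia), ih]
    ring

theorem IsTotallyPositiveOperator.derivativeResolvent {y : R} (hy : y ∈ S) :
    IsTotallyPositiveOperator S (derivativeResolvent y) := by
  simp only [IsTotallyPositiveOperator, derivativeResolvent_X_pow]
  exact MinorsMem.of_lower_triangular_of_mul
    (coeff_derivativeResolventXPow_mem hy)
    (fun _ _ => coeff_derivativeResolventXPow_of_lt y)
    (fun _ _ _ => coeff_derivativeResolventXPow_mul y)

end TotallyPositiveOperators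

section TreePolynomials

variable {R : Type*} [CommRing R] {S : Subsemiring R}

/-- The tree polynomials `(X + x + (n + 1) y) ^ n`. -/
noncomputable def treePoly (x y : R) (n : ℕ) : R[X] := (X + C (x + (n + 1) * y)) ^ n

/-- The Abel polynomials `(X + x) (X + x + n y) ^ (n - 1)`, with value `1` at `n = 0`. -/
noncomputable def abelPoly (x y : R) : ℕ → R[X]
  | 0 => 1
  | n + 1 => (X + C x) * treePoly x y n

theorem taylor_abelPoly (x y : R) (n : ℕ) :
    taylor y (abelPoly x y n) = treePoly x y n - C y * derivative (treePoly x y n) := by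
  cases n with
  | zero => simp [abelPoly, treePoly]
  | succ n =>
    simp only [abelPoly, treePoly, derivative_X_add_C_pow, Nat.add_sub_cancel]
    simp only [taylor_mul, taylor_pow, map_add, taylor_X, taylor_C]
    simp only [C_mul, C_add, map_natCast, map_one, Nat.cast_succ]
    ring

theorem derivativeResolvent_taylor_abelPoly (x y : R) (n : ℕ) :
    derivativeResolvent y (taylor y (abelPoly x y n)) = treePoly x y n := by
  rw [taylor_abelPoly, derivativeResolvent_sub_C_mul_derivative]

/-- The operator that maps each tree polynomial to the next one. -/
noncomputable def treeOperator (x y : R) : Module.End R R[X] :=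
  derivativeResolvent y * taylor y * LinearMap.mulLeft R (X + C x)

/-- The operator that maps each Abel polynomial to the next one. -/
noncomputable def abelOperator (x y : R) : Module.End R R[X] :=
  LinearMap.mulLeft R (X + C x) * (derivativeResolvent y * taylor y)

theorem treePoly_succ (x y : R) (n : ℕ) :
    treePoly x y (n + 1) = treeOperator x y (treePoly x y n) :=
  (derivativeResolvent_taylor_abelPoly x y (n + 1)).symm

theorem abelPoly_succ (x y : R) (n : ℕ) :
    abelPoly x y (n + 1) = abelOperator x y (abelPoly x y n) :=
  congrArg ((X + C x) * ·) (derivativeResolvent_taylor_abelPoly x y n).symm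

theorem IsTotallyPositiveOperator.treeOperator {x y : R} (hx : x ∈ S) (hy : y ∈ S) :
    IsTotallyPositiveOperator S (treeOperator x y) :=
  ((derivativeResolvent hy).mul (taylor hy)).mul (mulLeft_X_add_C hx)

theorem IsTotallyPositiveOperator.abelOperator {x y : R} (hx : x ∈ S) (hy : y ∈ S) :
    IsTotallyPositiveOperator S (abelOperator x y) :=
  (mulLeft_X_add_C hx).mul ((derivativeResolvent hy).mul (taylor hy))

theorem coeff_treePoly (x y : R) (n k : ℕ) :
    (treePoly x y n).coeff k = (x + (n + 1) * y) ^ (n - k) * n.choose k :=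
  coeff_X_add_C_pow _ _ _

theorem minorsMem_treeTriangle {x y : R} (hx : x ∈ S) (hy : y ∈ S) :
    MinorsMem S (Matrix.of fun n k : ℕ => (x + (n + 1) * y) ^ (n - k) * (n.choose k : R)) := by
  simpa only [coeffMatrix, coeff_treePoly] using
    (IsTotallyPositiveOperator.treeOperator hx hy).coeffMatrix_of_iterate
      (by simp [treePoly]) (treePoly_succ x y)

theorem minorsMem_hankelMatrix_tree {x y : R} (hx : x ∈ S) (hy : y ∈ S) :
    MinorsMem S (hankelMatrix fun n : ℕ => (x + (n + 1) * y) ^ n) := by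
  simpa [coeff_treePoly] using
    (IsTotallyPositiveOperator.treeOperator hx hy).minorsMem_hankelMatrix
      (by simp [treePoly]) (treePoly_succ x y)

theorem coeff_zero_abelPoly (x y : R) (n : ℕ) :
    (abelPoly x y n).coeff 0 = if n = 0 then 1 else x * (x + n * y) ^ (n - 1) := by
  cases n with
  | zero => simp [abelPoly]
  | succ n => simp [abelPoly, coeff_treePoly, mul_coeff_zero]

theorem minorsMem_hankelMatrix_abel {x y : R} (hx : x ∈ S) (hy : y ∈ S) :
    MinorsMem S
      (hankelMatrix fun n : ℕ => if n = 0 then 1 else x * (x + n * y) ^ (n - 1)) := by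
  simpa only [coeff_zero_abelPoly] using
    (IsTotallyPositiveOperator.abelOperator hx hy).minorsMem_hankelMatrix rfl (abelPoly_succ x y)

end TreePolynomials

section IdempotentTriangle

variable {R : Type*} [CommRing R]

theorem taylor_one_mul_derivative_pow_X_pow (n k : ℕ) :
    ((taylor (1 : R) * derivative : Module.End R R[X]) ^ k) (X ^ n) =
      n.descFactorial k • (X + C (k : R)) ^ (n - k) := by
  induction k with
  | zero => simp
  | succ k ih =>
    rw [pow_succ', Module.End.mul_apply, ih, Module.End.mul_apply, map_nsmul, map_nsmul,
      derivative_X_add_C_pow, ← smul_eq_C_mul, Nat.cast_smul_eq_nsmul, map_nsmul, taylor_pow,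
      map_add, taylor_X, taylor_C, smul_smul, mul_comm, ← Nat.descFactorial_succ, Nat.sub_sub,
      Nat.cast_succ, add_comm (k : R), C_add, add_assoc]

theorem minorsMem_idempotent_mul_factorial (S : Subsemiring R) :
    MinorsMem S (Matrix.of fun n k : ℕ =>
      (n.choose k : R) * (k : R) ^ (n - k) * (k.factorial : R)) := by
  have h := (IsTotallyPositiveOperator.taylor (one_mem S)).mul
    IsTotallyPositiveOperator.derivative |>.minorsMem_coeff_zero_pow
  convert h using 4 with n k
  rw [taylor_one_mul_derivative_pow_X_pow, coeff_smul, coeff_X_add_C_pow,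
    Nat.descFactorial_eq_factorial_mul_choose]
  simp only [Nat.sub_zero, Nat.choose_zero_right, Nat.cast_one, nsmul_eq_mul, Nat.cast_mul]
  ring

end IdempotentTriangle

section TotalPositivity

theorem isTotallyPositive_idempotent_mul_factorial :
    IsTotallyPositive (Matrix.of fun n k : ℕ =>
      (n.choose k : ℝ) * (k : ℝ) ^ (n - k) * (k.factorial : ℝ)) :=
  minorsMem_idempotent_mul_factorial (Subsemiring.nonneg ℝ)

theorem isTotallyPositive_idempotent :
    IsTotallyPositive (Matrix.of fun n k : ℕ => (n.choose k : ℝ) * (k : ℝ) ^ (n - k)) := by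
  have h := (minorsMem_idempotent_mul_factorial (Subsemiring.nonneg ℝ)).mul_col
    (c := fun k => (k.factorial : ℝ)⁻¹) fun k =>
      Subsemiring.mem_nonneg.2 (inv_nonneg.2 (Nat.cast_nonneg _))
  have factorial_ne_zero (k : ℕ) : (k.factorial : ℝ) ≠ 0 :=
    Nat.cast_ne_zero.2 k.factorial_ne_zero
  simp only [Matrix.of_apply, mul_inv_cancel_right₀ (factorial_ne_zero _)] at h
  exact h

theorem isTotallyPositive_inverseIdempotent :
    IsTotallyPositive (Matrix.of fun n k : ℕ+ =>
      (((n : ℕ) - 1).choose ((k : ℕ) - 1) : ℝ) * ((n : ℕ) : ℝ) ^ ((n : ℕ) - (k : ℕ))) := by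
  have h := (minorsMem_treeTriangle (zero_mem (Subsemiring.nonneg ℝ)) (one_mem _)).submatrix
    PNat.natPred_strictMono PNat.natPred_strictMono
  change MinorsMem (Subsemiring.nonneg ℝ) _
  convert h using 1
  ext n k
  have cast_natPred : ((n.natPred : ℝ) + 1) = (n : ℕ) := by exact_mod_cast n.natPred_add_one
  have natPred_sub : n.natPred - k.natPred = (n : ℕ) - k := by
    have := n.natPred_add_one
    have := k.natPred_add_one
    lia
  rw [Matrix.submatrix_apply, Matrix.of_apply, Matrix.of_apply, zero_add, mul_one, cast_natPred,
    natPred_sub, mul_comm]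
  rfl

theorem isTotallyPositive_inverseIdempotent_mul_factorial :
    IsTotallyPositive (Matrix.of fun n k : ℕ+ =>
      (((n : ℕ) - 1).choose ((k : ℕ) - 1) : ℝ) * ((n : ℕ) : ℝ) ^ ((n : ℕ) - (k : ℕ)) *
        ((k : ℕ).factorial : ℝ)) :=
  MinorsMem.mul_col (S := Subsemiring.nonneg ℝ) isTotallyPositive_inverseIdempotent
    (c := fun k : ℕ+ => ((k : ℕ).factorial : ℝ)) fun _ => natCast_mem _ _

end TotalPositivity

section LogConvexity

/-- The semiring of real polynomials with nonnegative coefficients; `MinorsMem` relative to it is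
`IsQTotallyPositive`. -/
def nonnegCoeffs : Subsemiring ℝ[X] where
  carrier := {p | HasNonnegCoeffs p}
  mul_mem' {p q} hp hq i := by
    rw [coeff_mul]
    exact Finset.sum_nonneg fun _ _ => mul_nonneg (hp _) (hq _)
  one_mem' i := by
    rw [coeff_one]
    positivity
  add_mem' {p q} hp hq i := by
    rw [coeff_add]
    exact add_nonneg (hp i) (hq i)
  zero_mem' i := (coeff_zero i).ge

theorem X_mem_nonnegCoeffs : X ∈ nonnegCoeffs := fun i => by
  rw [coeff_X]
  positivity

/-- The Hankel determinant of order `r` whose top left entry is `a i`. -/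
def hankelDet {R : Type*} [CommRing R] (a : ℕ → R) (r i : ℕ) : R :=
  (Matrix.of fun p q : Fin r => a (i + p + q)).det

theorem MinorsMem.hankelDet_mem {R : Type*} [CommRing R] {S : Subsemiring R} {a : ℕ → R}
    (h : MinorsMem S (hankelMatrix a)) (r i : ℕ) : hankelDet a r i ∈ S :=
  h r (fun p => i + p) Fin.val (fun _ _ hpq => Nat.add_lt_add_left hpq i) Fin.val_strictMono

theorem hankelDet_one {R : Type*} [CommRing R] (a : ℕ → R) (i : ℕ) : hankelDet a 1 i = a i := by
  simp [hankelDet]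

theorem hankelDet_two {R : Type*} [CommRing R] (a : ℕ → R) (i : ℕ) :
    hankelDet a 2 i = a i * a (i + 2) - a (i + 1) ^ 2 := by
  simp [hankelDet, Matrix.det_fin_two, add_assoc, sq]

theorem hankelDet_three {R : Type*} [CommRing R] (a : ℕ → R) (i : ℕ) :
    hankelDet a 3 i = a i * a (i + 2) * a (i + 4) + 2 * (a (i + 1) * a (i + 2) * a (i + 3)) -
      a (i + 2) ^ 3 - a i * a (i + 3) ^ 2 - a (i + 1) ^ 2 * a (i + 4) := by
  simp only [hankelDet, Matrix.det_fin_three, Matrix.of_apply, Fin.isValue, Fin.val_zero,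
    Fin.val_one, Fin.val_two, add_zero, add_assoc, Nat.reduceAdd]
  ring

/-- The **Desnanot–Jacobi identity** for Hankel determinants of order four. -/
theorem hankelDet_four_mul_hankelDet_two {R : Type*} [CommRing R] (a : ℕ → R) (i : ℕ) :
    hankelDet a 4 i * hankelDet a 2 (i + 2) =
      hankelDet a 3 i * hankelDet a 3 (i + 2) - hankelDet a 3 (i + 1) ^ 2 := by
  rw [hankelDet, Matrix.det_succ_row_zero]
  simp [Fin.sum_univ_succ, Matrix.det_fin_three, Fin.succAbove, add_assoc, hankelDet_two,
    hankelDet_three]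
  ring

theorem logConvexOp_eq_hankelDet (a : ℕ → ℝ[X]) (i : ℕ) : logConvexOp a i = hankelDet a 2 i :=
  (hankelDet_two a i).symm

theorem logConvexOp_iterate_two (a : ℕ → ℝ[X]) (i : ℕ) :
    logConvexOp^[2] a i = a (i + 2) * hankelDet a 3 i := by
  simp only [Function.iterate_succ, Function.iterate_zero, Function.comp_apply, id, logConvexOp,
    hankelDet_three, add_assoc, Nat.reduceAdd]
  ring

theorem logConvexOp_iterate_three (a : ℕ → ℝ[X]) (i : ℕ) :
    logConvexOp^[3] a i = a (i + 2) * a (i + 4) * (hankelDet a 4 i * hankelDet a 2 (i + 2)) +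
      hankelDet a 2 (i + 2) * hankelDet a 3 (i + 1) ^ 2 := by
  rw [hankelDet_four_mul_hankelDet_two, hankelDet_two, Function.iterate_succ_apply', logConvexOp]
  simp only [logConvexOp_iterate_two, add_assoc, Nat.reduceAdd]
  ring

theorem IsQStieltjesMoment.isKQLogConvex_three {a : ℕ → ℝ[X]} (h : IsQStieltjesMoment a) :
    IsKQLogConvex 3 a := by
  have det_mem : ∀ r i, hankelDet a r i ∈ nonnegCoeffs :=
    MinorsMem.hankelDet_mem (S := nonnegCoeffs) h
  have term_mem (i : ℕ) : a i ∈ nonnegCoeffs := hankelDet_one a i ▸ det_mem 1 i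
  intro m hm i
  change logConvexOp^[m] a i ∈ nonnegCoeffs
  interval_cases m
  · exact term_mem i
  · rw [Function.iterate_one, logConvexOp_eq_hankelDet]
    exact det_mem 2 i
  · rw [logConvexOp_iterate_two]
    exact mul_mem (term_mem _) (det_mem 3 _)
  · rw [logConvexOp_iterate_three]
    exact add_mem
      (mul_mem (mul_mem (term_mem _) (term_mem _)) (mul_mem (det_mem 4 _) (det_mem 2 _)))
      (mul_mem (det_mem 2 _) (pow_mem (det_mem 3 _) 2))

theorem inverseIdempotentPoly_succ (n : ℕ) :
    inverseIdempotentPoly (n + 1) = X * (X + C ((n : ℝ) + 1)) ^ n := by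
  rw [inverseIdempotentPoly, if_neg n.succ_ne_zero, Nat.add_sub_cancel, add_pow, Finset.mul_sum,
    Finset.range_eq_Ico, ← Finset.sum_Ico_add_right_sub_eq 0 (n + 1) 1]
  refine Finset.sum_congr rfl fun k hk => ?_
  obtain ⟨k, rfl⟩ := Nat.exists_eq_add_of_le' (Finset.mem_Icc.1 hk).1
  simp only [Nat.add_sub_cancel, Nat.add_sub_add_right, Nat.cast_succ, C_mul, C_pow, map_natCast]
  ring

theorem isQStieltjesMoment_inverseIdempotentPoly : IsQStieltjesMoment inverseIdempotentPoly := by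
  have poly_eq : inverseIdempotentPoly =
      fun n : ℕ => if n = 0 then 1 else X * (X + (n : ℝ[X]) * 1) ^ (n - 1) := by
    funext n
    cases n with
    | zero => rfl
    | succ n => simp [inverseIdempotentPoly_succ]
  rw [poly_eq]
  exact minorsMem_hankelMatrix_abel X_mem_nonnegCoeffs (one_mem nonnegCoeffs)

theorem isQStieltjesMoment_one_add_X_mul_C_pow :
    IsQStieltjesMoment fun i : ℕ => (1 + X * C ((i : ℝ) + 1)) ^ i := by
  have h := minorsMem_hankelMatrix_tree (one_mem nonnegCoeffs) X_mem_nonnegCoeffs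
  change MinorsMem nonnegCoeffs _
  simpa [mul_comm] using h

end LogConvexity

section PrincipalMinors

open Matrix

variable {n : Type*} [Fintype n] [DecidableEq n]

theorem eval_det_one_add_X_smul {R : Type*} [CommRing R] (M : Matrix n n R) (s : R) :
    (det (1 + (X : R[X]) • M.map C)).eval s = (1 + s • M).det := by
  rw [← coe_evalRingHom, RingHom.map_det]
  congr 1
  ext i j
  simp [one_apply, apply_ite (eval s), mul_comm (M i j)]

theorem det_one_add_smul_pos_of_principal_minors {R : Type*} [CommRing R] [LinearOrder R]
    [IsStrictOrderedRing R] {M : Matrix n n R}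
    (h : ∀ s : Finset n, 0 ≤ (M.submatrix (Subtype.val : s → n) Subtype.val).det)
    {c : R} (hc : 0 ≤ c) : 0 < (1 + c • M).det := by
  set p : R[X] := det (1 + (X : R[X]) • M.map C) with hp
  have coeff_nonneg (k : ℕ) : 0 ≤ p.coeff k := by
    rw [hp, coeff_det_one_add_X_smul_eq_sum_minors]
    exact Finset.sum_nonneg fun s _ => h s
  have coeff_zero : p.coeff 0 = 1 := by
    rw [hp, coeff_det_one_add_X_smul_eq_sum_minors]
    simp
  calc (0 : R) < p.coeff 0 * c ^ 0 := by rw [coeff_zero, pow_zero, mul_one]; exact one_pos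
    _ ≤ ∑ k ∈ Finset.range (p.natDegree + 1), p.coeff k * c ^ k :=
      Finset.single_le_sum (f := fun k => p.coeff k * c ^ k)
        (fun k _ => mul_nonneg (coeff_nonneg k) (pow_nonneg hc k))
        (Finset.mem_range.2 p.natDegree.succ_pos)
    _ = (1 + c • M).det := by rw [← eval_eq_sum_range, hp, eval_det_one_add_X_smul]

theorem posSemidef_of_principal_minors {ι : Type*} [Finite ι] [DecidableEq ι]
    {M : Matrix ι ι ℝ} (hM : M.IsHermitian)
    (h : ∀ s : Finset ι, 0 ≤ (M.submatrix (Subtype.val : s → ι) Subtype.val).det) :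
    M.PosSemidef := by
  cases nonempty_fintype ι
  rw [hM.posSemidef_iff_eigenvalues_nonneg]
  intro i
  by_contra! hneg
  -- A negative eigenvalue `-1 / c` would make `1 + c M` singular.
  have hpos := det_one_add_smul_pos_of_principal_minors h (c := (-hM.eigenvalues i)⁻¹)
    (inv_nonneg.2 (neg_nonneg.2 hneg.le))
  refine hpos.ne' (exists_mulVec_eq_zero_iff.1 ⟨⇑(hM.eigenvectorBasis i), fun h0 => ?_, ?_⟩)
  · exact hM.eigenvectorBasis.orthonormal.ne_zero i (PiLp.ext (congrFun h0))
  · rw [add_mulVec, one_mulVec, smul_mulVec, hM.mulVec_eigenvectorBasis, smul_smul,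
      inv_neg, neg_mul, inv_mul_cancel₀ hneg.ne, neg_one_smul, add_neg_cancel]

end PrincipalMinors

section HalfLine

theorem exists_eval_le_of_nonneg_on_halfLine {p : ℝ[X]} (hp : ∀ x, 0 ≤ x → 0 ≤ p.eval x)
    (hdeg : 0 < p.natDegree) : ∃ x₀, 0 ≤ x₀ ∧ ∀ x, 0 ≤ x → p.eval x₀ ≤ p.eval x := by
  have hdegree : 0 < p.degree := natDegree_pos_iff_degree_pos.1 hdeg
  have tendsto_top : Filter.Tendsto (fun x => p.eval x) Filter.atTop Filter.atTop := by
    refine p.tendsto_atTop_of_leadingCoeff_nonneg hdegree (le_of_not_gt fun hlead => ?_)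
    obtain ⟨x, hneg, hx⟩ :=
      (((p.tendsto_atBot_of_leadingCoeff_nonpos hdegree hlead.le).eventually
        (Filter.eventually_lt_atBot 0)).and (Filter.eventually_ge_atTop 0)).exists
    exact (hp x hx).not_gt hneg
  obtain ⟨b, hb⟩ := Filter.eventually_atTop.1
    (tendsto_top.eventually (Filter.eventually_ge_atTop (p.eval 0)))
  obtain ⟨x₀, hx₀, hmin⟩ := isCompact_Icc.exists_isMinOn
    (Set.nonempty_Icc.2 (le_max_right b 0)) p.continuous.continuousOn
  refine ⟨x₀, hx₀.1, fun x hx => ?_⟩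
  rcases le_total x (max b 0) with h | h
  · exact hmin ⟨hx, h⟩
  · exact (hmin ⟨le_rfl, le_max_right b 0⟩).trans (hb x ((le_max_left b 0).trans h))

theorem nonneg_on_halfLine_of_forall_ne {p : ℝ[X]} {x₀ : ℝ}
    (h : ∀ x, 0 ≤ x → x ≠ x₀ → 0 ≤ p.eval x) {x : ℝ} (hx : 0 ≤ x) : 0 ≤ p.eval x := by
  by_cases hne : x = x₀
  · refine ge_of_tendsto (p.continuous.continuousWithinAt (s := Set.Ioi x)) ?_
    filter_upwards [self_mem_nhdsWithin] with y (hy : x < y)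
    exact h y (hx.trans hy.le) (hne ▸ hy.ne')
  · exact h x hx hne

theorem sq_X_sub_C_dvd_of_isRoot_of_nonneg {p : ℝ[X]} (hp : ∀ x, 0 ≤ x → 0 ≤ p.eval x) {x₀ : ℝ}
    (hx₀ : 0 < x₀) (hroot : p.IsRoot x₀) : (X - C x₀) ^ 2 ∣ p := by
  rcases eq_or_ne p 0 with rfl | hne
  · exact dvd_zero _
  have localMin : IsLocalMin (fun x => p.eval x) x₀ := by
    filter_upwards [Ioi_mem_nhds hx₀] with x hx
    exact hroot.eq_zero.trans_le (hp x (le_of_lt hx))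
  have derivative_root : p.derivative.IsRoot x₀ := localMin.hasDerivAt_eq_zero (p.hasDerivAt x₀)
  exact (le_rootMultiplicity_iff hne).1
    ((one_lt_rootMultiplicity_iff_isRoot hne).2 ⟨hroot, derivative_root⟩)

/-- The preordering of `ℝ[X]` generated by `X`: the certificates of nonnegativity on the
half-line built from `X` and squares. -/
noncomputable def halfLinePreordering : Subsemiring ℝ[X] :=
  Subsemiring.closure (insert X {p | IsSquare p})

theorem X_mem_halfLinePreordering : X ∈ halfLinePreordering :=
  Subsemiring.subset_closure (Set.mem_insert X _)

theorem sq_mem_halfLinePreordering (p : ℝ[X]) : p ^ 2 ∈ halfLinePreordering :=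
  Subsemiring.subset_closure (Set.mem_insert_of_mem X (IsSquare.sq p))

theorem C_mem_halfLinePreordering {c : ℝ} (hc : 0 ≤ c) : C c ∈ halfLinePreordering := by
  rw [← Real.sq_sqrt hc, C_pow]
  exact sq_mem_halfLinePreordering _

theorem exists_mem_halfLinePreordering_dvd {p : ℝ[X]} (hp : ∀ x, 0 ≤ x → 0 ≤ p.eval x) {x₀ : ℝ}
    (hx₀ : 0 ≤ x₀) (hroot : p.IsRoot x₀) :
    ∃ d ∈ halfLinePreordering, 0 < d.natDegree ∧ (∀ x, 0 ≤ x → x ≠ x₀ → 0 < d.eval x) ∧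
      d ∣ p := by
  rcases hx₀.eq_or_lt with rfl | hpos
  · refine ⟨X, X_mem_halfLinePreordering, by simp, fun x hx hne => ?_, ?_⟩
    · simpa using hx.lt_of_ne' hne
    · simpa using dvd_iff_isRoot.2 hroot
  · refine ⟨(X - C x₀) ^ 2, sq_mem_halfLinePreordering _, by simp, fun x _ hne => ?_,
      sq_X_sub_C_dvd_of_isRoot_of_nonneg hp hpos hroot⟩
    have := sub_ne_zero.2 hne
    simp only [eval_pow, eval_sub, eval_X, eval_C]
    positivity

theorem mem_halfLinePreordering {p : ℝ[X]} (hp : ∀ x, 0 ≤ x → 0 ≤ p.eval x) :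
    p ∈ halfLinePreordering := by
  induction hdeg : p.natDegree using Nat.strong_induction_on generalizing p with
  | _ n ih =>
    rcases n.eq_zero_or_pos with rfl | hn
    · rw [eq_C_of_natDegree_eq_zero hdeg] at hp ⊢
      exact C_mem_halfLinePreordering (by simpa using hp 0 le_rfl)
    obtain ⟨x₀, hx₀, hmin⟩ := exists_eval_le_of_nonneg_on_halfLine hp (hdeg ▸ hn)
    set q := p - C (p.eval x₀) with hq
    have q_natDegree : q.natDegree = n := natDegree_sub_C.trans hdeg
    have q_nonneg (x : ℝ) (hx : 0 ≤ x) : 0 ≤ q.eval x := by simpa [hq] using hmin x hx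
    obtain ⟨d, hd, d_natDegree, d_pos, r, hr⟩ :=
      exists_mem_halfLinePreordering_dvd q_nonneg hx₀ (by simp [hq])
    have r_nonneg (x : ℝ) (hx : 0 ≤ x) : 0 ≤ r.eval x := by
      refine nonneg_on_halfLine_of_forall_ne (x₀ := x₀) (fun y hy hne => ?_) hx
      refine nonneg_of_mul_nonneg_right ?_ (d_pos y hy hne)
      rw [← eval_mul, ← hr]
      exact q_nonneg y hy
    have r_natDegree : r.natDegree < n := by
      have hne : d * r ≠ 0 := hr ▸ ne_zero_of_natDegree_gt (q_natDegree ▸ hn)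
      rw [← q_natDegree, hr, natDegree_mul (left_ne_zero_of_mul hne) (right_ne_zero_of_mul hne)]
      lia
    rw [← sub_add_cancel p (C (p.eval x₀)), ← hq, hr]
    exact add_mem (mul_mem hd (ih _ r_natDegree r_nonneg rfl))
      (C_mem_halfLinePreordering (hp x₀ hx₀))

/-- The two families of quadratic conditions on a functional that characterise, by Stieltjes'
theorem, moment functionals of measures on the half-line. -/
def IsStieltjesPositive (L : ℝ[X] →ₗ[ℝ] ℝ) : Prop :=
  ∀ q, 0 ≤ L (q ^ 2) ∧ 0 ≤ L (X * q ^ 2)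

namespace IsStieltjesPositive

theorem comp_mulLeft {p : ℝ[X]} (hp : p ∈ halfLinePreordering) :
    ∀ {L : ℝ[X] →ₗ[ℝ] ℝ}, IsStieltjesPositive L →
      IsStieltjesPositive (L ∘ₗ LinearMap.mulLeft ℝ p) := by
  induction hp using Subsemiring.closure_induction with
  | mem p hp =>
    intro L hL q
    simp only [LinearMap.comp_apply, LinearMap.mulLeft_apply]
    rcases hp with rfl | ⟨s, rfl⟩
    · refine ⟨(hL q).2, ?_⟩
      convert (hL (X * q)).1 using 2
      ring
    · constructor
      · convert (hL (s * q)).1 using 2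
        ring
      · convert (hL (s * q)).2 using 2
        ring
  | zero => intro L _ q; simp
  | one => intro L hL q; simpa using hL q
  | add p r _ _ ihp ihr =>
    intro L hL q
    simpa [add_mul] using
      And.intro (add_nonneg (ihp hL q).1 (ihr hL q).1) (add_nonneg (ihp hL q).2 (ihr hL q).2)
  | mul p r _ _ ihp ihr =>
    intro L hL
    rw [LinearMap.mulLeft_mul, ← LinearMap.comp_assoc]
    exact ihr (ihp hL)

theorem nonneg {L : ℝ[X] →ₗ[ℝ] ℝ} (hL : IsStieltjesPositive L) {p : ℝ[X]}
    (hp : ∀ x, 0 ≤ x → 0 ≤ p.eval x) : 0 ≤ L p := by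
  simpa using (hL.comp_mulLeft (mem_halfLinePreordering hp) 1).1

end IsStieltjesPositive

end HalfLine

section RieszFunctional

/-- The linear functional on polynomials that maps `X ^ n` to `a n`. -/
noncomputable def rieszFunctional (a : ℕ → ℝ) : ℝ[X] →ₗ[ℝ] ℝ :=
  (basisMonomials ℝ).constr ℝ a

theorem rieszFunctional_X_pow (a : ℕ → ℝ) (n : ℕ) : rieszFunctional a (X ^ n) = a n := by
  rw [← monomial_one_right_eq_X_pow]
  exact (basisMonomials ℝ).constr_basis ℝ a n

theorem rieszFunctional_apply (a : ℕ → ℝ) (p : ℝ[X]) :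
    rieszFunctional a p = ∑ n ∈ Finset.range (p.natDegree + 1), p.coeff n * a n := by
  simp only [linearMap_apply_eq_sum_coeff_mul _ p.natDegree.lt_succ_self, rieszFunctional_X_pow,
    Fin.sum_univ_eq_sum_range fun n => p.coeff n * a n]

theorem rieszFunctional_geometric (s : ℝ) (p : ℝ[X]) :
    rieszFunctional (fun n => s ^ n) p = p.eval s := by
  rw [rieszFunctional_apply, eval_eq_sum_range]

theorem rieszFunctional_X_mul (a : ℕ → ℝ) (p : ℝ[X]) :
    rieszFunctional a (X * p) = rieszFunctional (fun n => a (n + 1)) p := by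
  suffices h : rieszFunctional a ∘ₗ LinearMap.mulLeft ℝ X = rieszFunctional fun n => a (n + 1) from
    LinearMap.congr_fun h p
  refine (basisMonomials ℝ).ext fun n => ?_
  simp [rieszFunctional_X_pow, monomial_one_right_eq_X_pow, ← pow_succ']

theorem rieszFunctional_sq_eq_dotProduct (a : ℕ → ℝ) {p : ℝ[X]} {N : ℕ} (hN : p.natDegree < N) :
    rieszFunctional a (p ^ 2) = (fun i : Fin N => p.coeff i) ⬝ᵥ
      ((hankelMatrix a).submatrix Fin.val Fin.val).mulVec fun i : Fin N => p.coeff i := by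
  have expand_left (q : ℝ[X]) :
      rieszFunctional a (p * q) = ∑ i : Fin N, p.coeff i * rieszFunctional a (X ^ (i : ℕ) * q) :=
    linearMap_apply_eq_sum_coeff_mul (rieszFunctional a ∘ₗ LinearMap.mulRight ℝ q) hN
  have expand_right (i : ℕ) :
      rieszFunctional a (X ^ i * p) = ∑ j : Fin N, p.coeff j * a (i + j) := by
    simp only [mul_comm _ p, expand_left, ← pow_add, rieszFunctional_X_pow, add_comm]
  simp only [sq, expand_left, expand_right, dotProduct, Matrix.mulVec, Matrix.submatrix_apply,
    hankelMatrix, Matrix.of_apply, mul_comm (a _)]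

theorem rieszFunctional_sq_nonneg {a : ℕ → ℝ} (h : IsTotallyPositive (hankelMatrix a))
    (p : ℝ[X]) : 0 ≤ rieszFunctional a (p ^ 2) := by
  rw [rieszFunctional_sq_eq_dotProduct a p.natDegree.lt_succ_self]
  refine Matrix.PosSemidef.dotProduct_mulVec_nonneg (posSemidef_of_principal_minors ?_ ?_) _
  · ext i j
    simp [hankelMatrix, add_comm]
  · intro s
    set e := s.orderIsoOfFin rfl
    rw [← Matrix.det_submatrix_equiv_self e.toEquiv]
    have strictMono_val : StrictMono fun i => ((e i : Fin (p.natDegree + 1)) : ℕ) :=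
      fun _ _ hij => e.strictMono hij
    exact h s.card _ _ strictMono_val strictMono_val

theorem isStieltjesPositive_rieszFunctional {a : ℕ → ℝ}
    (h : IsTotallyPositive (hankelMatrix a)) : IsStieltjesPositive (rieszFunctional a) := by
  refine fun q => ⟨rieszFunctional_sq_nonneg h q, ?_⟩
  rw [rieszFunctional_X_mul]
  refine rieszFunctional_sq_nonneg ?_ q
  have shift_eq : hankelMatrix (fun n => a (n + 1)) = (hankelMatrix a).submatrix Nat.succ id := by
    ext i j
    exact congrArg a (Nat.succ_add i j).symm
  rw [shift_eq]
  exact MinorsMem.submatrix (S := Subsemiring.nonneg ℝ) h (fun _ _ => Nat.succ_lt_succ)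
    strictMono_id

end RieszFunctional

section MomentProblem

open MeasureTheory Filter Topology
open scoped NNReal CompactlySupported

/-- The functions on the half-line bounded by a polynomial. Riesz extension takes place here: the
space contains the polynomials, which are cofinal in it, and the compactly supported functions. -/
def polynomialGrowth : Submodule ℝ (ℝ≥0 → ℝ) where
  carrier := {f | ∃ p : ℝ[X], ∀ x : ℝ≥0, |f x| ≤ p.eval (x : ℝ)}
  add_mem' := by
    rintro f g ⟨p, hp⟩ ⟨q, hq⟩
    refine ⟨p + q, fun x => ?_⟩
    rw [eval_add]
    exact (abs_add_le _ _).trans (add_le_add (hp x) (hq x))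
  zero_mem' := ⟨0, by simp⟩
  smul_mem' := by
    rintro c f ⟨p, hp⟩
    refine ⟨C |c| * p, fun x => ?_⟩
    rw [eval_mul, eval_C, Pi.smul_apply, smul_eq_mul, abs_mul]
    exact mul_le_mul_of_nonneg_left (hp x) (abs_nonneg c)

theorem abs_eval_le_eval_one_add_sq (x : ℝ) (p : ℝ[X]) : |p.eval x| ≤ (1 + p ^ 2).eval x := by
  simp only [eval_add, eval_one, eval_pow]
  rw [abs_le]
  constructor <;> nlinarith [sq_nonneg (p.eval x - 1), sq_nonneg (p.eval x + 1)]

/-- Polynomials as functions on the half-line. -/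
noncomputable def polynomialToFun : ℝ[X] →ₗ[ℝ] polynomialGrowth where
  toFun p := ⟨fun x => p.eval (x : ℝ), 1 + p ^ 2, fun x => abs_eval_le_eval_one_add_sq x p⟩
  map_add' p q := by ext x; simp
  map_smul' c p := by ext x; simp

theorem polynomialToFun_injective : Function.Injective polynomialToFun := by
  intro p q h
  refine eq_of_infinite_eval_eq p q ((Set.Ici_infinite (0 : ℝ)).mono fun x hx => ?_)
  exact congrFun (congrArg Subtype.val h) ⟨x, hx⟩

theorem exists_positiveLinearMap_extension {L : ℝ[X] →ₗ[ℝ] ℝ}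
    (hL : ∀ p : ℝ[X], (∀ x, 0 ≤ x → 0 ≤ p.eval x) → 0 ≤ L p) :
    ∃ g : polynomialGrowth →ₚ[ℝ] ℝ, ∀ p, g (polynomialToFun p) = L p := by
  set e := LinearEquiv.ofInjective polynomialToFun polynomialToFun_injective
  obtain ⟨g, g_extends, g_nonneg⟩ := riesz_extension
    ((PointedCone.positive ℝ (ℝ≥0 → ℝ)).comap polynomialGrowth.subtype)
    ⟨LinearMap.range polynomialToFun, L ∘ₗ e.symm.toLinearMap⟩
    (by
      intro f hf
      obtain ⟨p, rfl⟩ := e.surjective f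
      change 0 ≤ L (e.symm (e p))
      rw [LinearEquiv.symm_apply_apply]
      exact hL p fun x hx => hf ⟨x, hx⟩)
    (by
      rintro ⟨f, p, hp⟩
      refine ⟨e p, fun x => ?_⟩
      exact neg_le_iff_add_nonneg.1 ((neg_le_abs (f x)).trans (hp x)))
  refine ⟨PositiveLinearMap.mk₀ g g_nonneg, fun p => (g_extends (e p)).trans ?_⟩
  exact congrArg L (e.symm_apply_apply p)

/-- The inclusion of the compactly supported continuous functions on the half-line into those of
polynomial growth. -/
noncomputable def compactlySupportedToFun : C_c(ℝ≥0, ℝ) →ₗ[ℝ] polynomialGrowth where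
  toFun f := ⟨f, by
    obtain ⟨c, hc⟩ := f.hasCompactSupport.exists_bound_of_continuous f.continuous
    exact ⟨C c, fun x => by simpa using hc x⟩⟩
  map_add' f g := rfl
  map_smul' c f := rfl

/-- The function `x ^ k` cut off linearly at `N + 1`. -/
noncomputable def truncatedPow (k N : ℕ) : C_c(ℝ≥0, ℝ) where
  toFun x := (x : ℝ) ^ k * max 0 (1 - (x : ℝ) / (N + 1))
  continuous_toFun := by fun_prop
  hasCompactSupport' := by
    refine HasCompactSupport.intro (isCompact_Icc (a := (0 : ℝ≥0)) (b := N + 1)) fun x hx => ?_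
    have x_gt : (N : ℝ) + 1 < x := by
      by_contra! hle
      exact hx ⟨zero_le, by exact_mod_cast hle⟩
    have : 1 ≤ (x : ℝ) / (N + 1) := (one_le_div (by positivity)).2 x_gt.le
    rw [max_eq_left (by linarith), mul_zero]

theorem truncatedPow_apply (k N : ℕ) (x : ℝ≥0) :
    truncatedPow k N x = (x : ℝ) ^ k * max 0 (1 - (x : ℝ) / (N + 1)) := rfl

theorem truncatedPow_nonneg (k N : ℕ) (x : ℝ≥0) : 0 ≤ truncatedPow k N x :=
  mul_nonneg (pow_nonneg x.2 k) (le_max_left _ _)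

theorem truncatedPow_le_pow (k N : ℕ) (x : ℝ≥0) : truncatedPow k N x ≤ (x : ℝ) ^ k :=
  mul_le_of_le_one_right (pow_nonneg x.2 k)
    (max_le zero_le_one (sub_le_self 1 (div_nonneg x.2 (by positivity))))

theorem pow_sub_pow_succ_le_truncatedPow (k N : ℕ) (x : ℝ≥0) :
    (x : ℝ) ^ k - 1 / ((N : ℝ) + 1) * (x : ℝ) ^ (k + 1) ≤ truncatedPow k N x :=
  calc (x : ℝ) ^ k - 1 / ((N : ℝ) + 1) * (x : ℝ) ^ (k + 1)
      = (x : ℝ) ^ k * (1 - (x : ℝ) / (N + 1)) := by ring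
    _ ≤ truncatedPow k N x := mul_le_mul_of_nonneg_left (le_max_right _ _) (pow_nonneg x.2 k)

theorem monotone_truncatedPow (k : ℕ) (x : ℝ≥0) : Monotone fun N => truncatedPow k N x := by
  intro M N h
  simp only [truncatedPow_apply]
  gcongr

theorem tendsto_sub_one_div_mul (a b : ℝ) :
    Tendsto (fun N : ℕ => a - 1 / ((N : ℝ) + 1) * b) atTop (𝓝 a) := by
  simpa using tendsto_const_nhds.sub (tendsto_one_div_add_atTop_nhds_zero_nat.mul_const b)

theorem tendsto_truncatedPow (k : ℕ) (x : ℝ≥0) :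
    Tendsto (fun N => truncatedPow k N x) atTop (𝓝 ((x : ℝ) ^ k)) :=
  tendsto_of_tendsto_of_tendsto_of_le_of_le (tendsto_sub_one_div_mul _ _) tendsto_const_nhds
    (fun N => pow_sub_pow_succ_le_truncatedPow k N x) fun N => truncatedPow_le_pow k N x

theorem tendsto_positiveLinearMap_truncatedPow (g : polynomialGrowth →ₚ[ℝ] ℝ) (k : ℕ) :
    Tendsto (fun N => g (compactlySupportedToFun (truncatedPow k N))) atTop
      (𝓝 (g (polynomialToFun (X ^ k)))) := by
  refine tendsto_of_tendsto_of_tendsto_of_le_of_le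
    (tendsto_sub_one_div_mul _ (g (polynomialToFun (X ^ (k + 1))))) tendsto_const_nhds
    (fun N => ?_) fun N => ?_
  · simp only [← smul_eq_mul, ← map_smul, ← map_sub]
    refine OrderHomClass.mono g fun x => ?_
    simpa [polynomialToFun, compactlySupportedToFun] using pow_sub_pow_succ_le_truncatedPow k N x
  · refine OrderHomClass.mono g fun x => ?_
    simpa [polynomialToFun, compactlySupportedToFun] using truncatedPow_le_pow k N x

theorem lintegral_pow_eq_of_tendsto {μ : Measure ℝ≥0} [IsFiniteMeasureOnCompacts μ] {k : ℕ}
    {c : ℝ} (h : Tendsto (fun N => ∫ x, truncatedPow k N x ∂μ) atTop (𝓝 c)) :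
    ∫⁻ x : ℝ≥0, ENNReal.ofReal ((x : ℝ) ^ k) ∂μ = ENNReal.ofReal c := by
  have lintegral_truncatedPow (N : ℕ) : ∫⁻ x, ENNReal.ofReal (truncatedPow k N x) ∂μ =
      ENNReal.ofReal (∫ x, truncatedPow k N x ∂μ) :=
    (ofReal_integral_eq_lintegral_ofReal
      ((truncatedPow k N).continuous.integrable_of_hasCompactSupport
        (truncatedPow k N).hasCompactSupport)
      (Eventually.of_forall (truncatedPow_nonneg k N))).symm
  have monotoneConvergence := lintegral_tendsto_of_tendsto_of_monotone (μ := μ)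
    (f := fun N x => ENNReal.ofReal (truncatedPow k N x))
    (F := fun x => ENNReal.ofReal ((x : ℝ) ^ k))
    (fun N => (truncatedPow k N).continuous.measurable.ennreal_ofReal.aemeasurable)
    (Eventually.of_forall fun x _ _ hMN => ENNReal.ofReal_le_ofReal (monotone_truncatedPow k x hMN))
    (Eventually.of_forall fun x => ENNReal.tendsto_ofReal (tendsto_truncatedPow k x))
  simp only [lintegral_truncatedPow] at monotoneConvergence
  exact tendsto_nhds_unique monotoneConvergence (ENNReal.tendsto_ofReal h)

theorem exists_measure_of_nonneg {L : ℝ[X] →ₗ[ℝ] ℝ}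
    (hL : ∀ p : ℝ[X], (∀ x, 0 ≤ x → 0 ≤ p.eval x) → 0 ≤ L p) :
    ∃ μ : Measure ℝ≥0, ∀ k : ℕ, Integrable (fun x : ℝ≥0 => (x : ℝ) ^ k) μ ∧
      ∫ x : ℝ≥0, (x : ℝ) ^ k ∂μ = L (X ^ k) := by
  obtain ⟨g, hg⟩ := exists_positiveLinearMap_extension hL
  let Λ : C_c(ℝ≥0, ℝ) →ₚ[ℝ] ℝ := PositiveLinearMap.mk₀ (g.toLinearMap ∘ₗ compactlySupportedToFun)
    fun f hf => map_nonneg g (a := compactlySupportedToFun f) hf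
  refine ⟨RealRMK.rieszMeasure Λ, fun k => ?_⟩
  have integral_tendsto : Tendsto (fun N => ∫ x, truncatedPow k N x ∂(RealRMK.rieszMeasure Λ)) atTop
      (𝓝 (L (X ^ k))) := by
    simp only [RealRMK.integral_rieszMeasure, ← hg]
    exact tendsto_positiveLinearMap_truncatedPow g k
  have lintegral_eq := lintegral_pow_eq_of_tendsto integral_tendsto
  have pow_nonneg_ae : 0 ≤ᵐ[RealRMK.rieszMeasure Λ] fun x : ℝ≥0 => (x : ℝ) ^ k :=
    Eventually.of_forall fun x => pow_nonneg x.2 k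
  have pow_aesm : AEStronglyMeasurable (fun x : ℝ≥0 => (x : ℝ) ^ k) (RealRMK.rieszMeasure Λ) :=
    (by fun_prop : Continuous fun x : ℝ≥0 => (x : ℝ) ^ k).aestronglyMeasurable
  constructor
  · rw [← lintegral_ofReal_ne_top_iff_integrable pow_aesm pow_nonneg_ae, lintegral_eq]
    exact ENNReal.ofReal_ne_top
  · rw [integral_eq_lintegral_of_nonneg_ae pow_nonneg_ae pow_aesm, lintegral_eq]
    exact ENNReal.toReal_ofReal (hL _ fun x hx => by simpa using pow_nonneg hx k)

theorem isStieltjesMoment_of_rieszFunctional_nonneg {a : ℕ → ℝ}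
    (h : ∀ p : ℝ[X], (∀ x, 0 ≤ x → 0 ≤ p.eval x) → 0 ≤ rieszFunctional a p) :
    IsStieltjesMoment a := by
  obtain ⟨μ, hμ⟩ := exists_measure_of_nonneg h
  have coe_aemeasurable : AEMeasurable ((↑) : ℝ≥0 → ℝ) μ := measurable_coe_nnreal_real.aemeasurable
  have restrict_map : (μ.map ((↑) : ℝ≥0 → ℝ)).restrict (Set.Ici 0) = μ.map (↑) :=
    Measure.restrict_eq_self_of_ae_mem <|
      (ae_map_iff (p := (· ∈ Set.Ici (0 : ℝ))) coe_aemeasurable measurableSet_Ici).2 <|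
        Eventually.of_forall NNReal.coe_nonneg
  refine ⟨μ.map (↑), fun k => ?_⟩
  have pow_aesm : AEStronglyMeasurable (fun x : ℝ => x ^ k) (μ.map ((↑) : ℝ≥0 → ℝ)) :=
    (continuous_pow k).aestronglyMeasurable
  constructor
  · rw [IntegrableOn, restrict_map, integrable_map_measure pow_aesm coe_aemeasurable]
    exact (hμ k).1
  · rw [restrict_map, integral_map coe_aemeasurable pow_aesm, (hμ k).2, rieszFunctional_X_pow]

theorem IsStieltjesMoment.rieszFunctional_nonneg {a : ℕ → ℝ} (ha : IsStieltjesMoment a)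
    {p : ℝ[X]} (hp : ∀ x, 0 ≤ x → 0 ≤ p.eval x) : 0 ≤ rieszFunctional a p := by
  obtain ⟨μ, hμ⟩ := ha
  calc 0 ≤ ∫ x in Set.Ici (0 : ℝ), p.eval x ∂μ := setIntegral_nonneg measurableSet_Ici hp
    _ = rieszFunctional a p := by
      simp only [eval_eq_sum_range, rieszFunctional_apply]
      rw [integral_finsetSum _ fun n _ => (hμ n).1.const_mul _]
      exact Finset.sum_congr rfl fun n _ => by rw [integral_const_mul, (hμ n).2]

theorem isStieltjesMoment_of_isTotallyPositive_hankelMatrix {a : ℕ → ℝ}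
    (h : IsTotallyPositive (hankelMatrix a)) : IsStieltjesMoment a :=
  isStieltjesMoment_of_rieszFunctional_nonneg fun _ =>
    (isStieltjesPositive_rieszFunctional h).nonneg

end MomentProblem

section Convolution

theorem exists_rieszFunctional_triangleConvolution_left (A : ℕ → ℕ → ℝ) (y : ℕ → ℝ) (p : ℝ[X]) :
    ∃ q, ∀ x, rieszFunctional (triangleConvolution A x y) p = rieszFunctional x q := by
  refine ⟨∑ n ∈ Finset.range (p.natDegree + 1), ∑ k ∈ Finset.range (n + 1),
    (p.coeff n * A n k * y (n - k)) • X ^ k, fun x => ?_⟩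
  simp only [rieszFunctional_apply _ p, triangleConvolution, map_sum, map_smul,
    rieszFunctional_X_pow, smul_eq_mul, Finset.mul_sum]
  exact Finset.sum_congr rfl fun n _ => Finset.sum_congr rfl fun k _ => by ring

theorem exists_rieszFunctional_triangleConvolution_right (A : ℕ → ℕ → ℝ) (x : ℕ → ℝ) (p : ℝ[X]) :
    ∃ q, ∀ y, rieszFunctional (triangleConvolution A x y) p = rieszFunctional y q := by
  refine ⟨∑ n ∈ Finset.range (p.natDegree + 1), ∑ k ∈ Finset.range (n + 1),
    (p.coeff n * A n k * x k) • X ^ (n - k), fun y => ?_⟩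
  simp only [rieszFunctional_apply _ p, triangleConvolution, map_sum, map_smul,
    rieszFunctional_X_pow, smul_eq_mul, Finset.mul_sum, mul_assoc]

-- Geometric sequences are the moments of point masses, so this is the reduction to point masses.
theorem convolutionPreservesSM_of_geometric {A : ℕ → ℕ → ℝ}
    (h : ∀ s t : ℝ, 0 ≤ s → 0 ≤ t →
      IsStieltjesMoment (triangleConvolution A (fun n => s ^ n) fun n => t ^ n)) :
    ConvolutionPreservesSM A := by
  refine fun x y hx hy => isStieltjesMoment_of_rieszFunctional_nonneg fun p hp => ?_
  obtain ⟨q, hq⟩ := exists_rieszFunctional_triangleConvolution_right A x p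
  rw [hq]
  refine hy.rieszFunctional_nonneg fun t ht => ?_
  obtain ⟨r, hr⟩ := exists_rieszFunctional_triangleConvolution_left A (fun n => t ^ n) p
  rw [← rieszFunctional_geometric, ← hq, hr]
  refine hx.rieszFunctional_nonneg fun s hs => ?_
  rw [← rieszFunctional_geometric, ← hr]
  exact (h s t hs ht).rieszFunctional_nonneg hp

theorem isStieltjesMoment_tree {x y : ℝ} (hx : 0 ≤ x) (hy : 0 ≤ y) :
    IsStieltjesMoment fun n : ℕ => (x + ((n : ℝ) + 1) * y) ^ n :=
  isStieltjesMoment_of_isTotallyPositive_hankelMatrix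
    (minorsMem_hankelMatrix_tree (S := Subsemiring.nonneg ℝ) hx hy)

theorem isStieltjesMoment_abel {x y : ℝ} (hx : 0 ≤ x) (hy : 0 ≤ y) :
    IsStieltjesMoment fun n : ℕ => if n = 0 then 1 else x * (x + n * y) ^ (n - 1) :=
  isStieltjesMoment_of_isTotallyPositive_hankelMatrix
    (minorsMem_hankelMatrix_abel (S := Subsemiring.nonneg ℝ) hx hy)

theorem isStieltjesMoment_succ_pow : IsStieltjesMoment fun n : ℕ => ((n : ℝ) + 1) ^ n := by
  simpa using isStieltjesMoment_tree le_rfl zero_le_one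

theorem convolutionPreservesSM_choose_mul_succ_pow : ConvolutionPreservesSM fun n k : ℕ =>
    (n.choose k : ℝ) * ((n : ℝ) + 1) ^ (n - k) := by
  refine convolutionPreservesSM_of_geometric fun s t hs ht => ?_
  convert isStieltjesMoment_tree hs ht using 2 with n
  rw [triangleConvolution, add_pow]
  exact Finset.sum_congr rfl fun k _ => by rw [mul_pow]; ring

theorem convolutionPreservesSM_inverseIdempotent : ConvolutionPreservesSM inverseIdempotent := by
  refine convolutionPreservesSM_of_geometric fun s t hs ht => ?_
  convert isStieltjesMoment_abel hs ht using 2 with n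
  rcases n with _ | n
  · simp [triangleConvolution, inverseIdempotent]
  · rw [triangleConvolution, Finset.sum_range_succ', if_neg n.succ_ne_zero, add_tsub_cancel_right,
      add_pow, Finset.mul_sum]
    simp only [inverseIdempotent, Nat.add_one_ne_zero, and_false, false_or, or_true, if_true,
      if_false, zero_mul, add_zero, Nat.add_sub_cancel, Nat.add_sub_add_right, false_and]
    exact Finset.sum_congr rfl fun k _ => by rw [mul_pow, pow_succ]; ring

end Convolution

theorem mainTheorem12 :
    -- (i)
    (IsTotallyPositive (Matrix.of fun n k : ℕ => (n.choose k : ℝ) * (k : ℝ) ^ (n - k)) ∧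
      IsTotallyPositive (Matrix.of fun n k : ℕ+ =>
        (((n : ℕ) - 1).choose ((k : ℕ) - 1) : ℝ) * ((n : ℕ) : ℝ) ^ ((n : ℕ) - (k : ℕ)))) ∧
    -- (ii)
    (IsTotallyPositive (Matrix.of fun n k : ℕ =>
        (n.choose k : ℝ) * (k : ℝ) ^ (n - k) * (k.factorial : ℝ)) ∧
      IsTotallyPositive (Matrix.of fun n k : ℕ+ =>
        (((n : ℕ) - 1).choose ((k : ℕ) - 1) : ℝ) * ((n : ℕ) : ℝ) ^ ((n : ℕ) - (k : ℕ)) *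
          ((k : ℕ).factorial : ℝ))) ∧
    -- (iii)
    (IsQStieltjesMoment inverseIdempotentPoly ∧ IsKQLogConvex 3 inverseIdempotentPoly) ∧
    -- (iv): the sequence `(1 + q n)^(n - 1)`, `n ≥ 1`, with `n = i + 1`
    (IsQStieltjesMoment (fun i : ℕ => (1 + X * C ((i : ℝ) + 1)) ^ i) ∧
      IsKQLogConvex 3 (fun i : ℕ => (1 + X * C ((i : ℝ) + 1)) ^ i)) ∧
    -- (v): the sequence `n^(n - 1)`, `n ≥ 1`, with `n = i + 1`
    IsStieltjesMoment (fun i : ℕ => ((i : ℝ) + 1) ^ i) ∧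
    -- (vi)
    (ConvolutionPreservesSM inverseIdempotent ∧
      ConvolutionPreservesSM (fun n k : ℕ =>
        (n.choose k : ℝ) * ((n : ℝ) + 1) ^ (n - k))) :=
  ⟨⟨isTotallyPositive_idempotent, isTotallyPositive_inverseIdempotent⟩,
    ⟨isTotallyPositive_idempotent_mul_factorial, isTotallyPositive_inverseIdempotent_mul_factorial⟩,
    ⟨isQStieltjesMoment_inverseIdempotentPoly,
      isQStieltjesMoment_inverseIdempotentPoly.isKQLogConvex_three⟩,
    ⟨isQStieltjesMoment_one_add_X_mul_C_pow,
      isQStieltjesMoment_one_add_X_mul_C_pow.isKQLogConvex_three⟩,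
    isStieltjesMoment_succ_pow,
    convolutionPreservesSM_inverseIdempotent, convolutionPreservesSM_choose_mul_succ_pow⟩
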